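/- Let $d\ge 1$. For $A\subset\mathbb Z^d$ and $N\in\mathbb N$ put $A_N=A\cap[-N,N]^d$ and $H_N(k;A)=\frac{\mathrm{card}(A_N\cap(k+A_N))}{(2N+1)^d}$, $k\in\mathbb Z^d$. The set $A$ is called asymptotically measurable if for every $k\in\mathbb Z^d$ the limit $H(k;A)=\lim_{N\to\infty}H_N(k;A)$ exists. For a real random field $X=(X_n)_{n\in\mathbb Z^d}$ put $S_N(A,X)=(2N+1)^{-d/2}\sum_{n\in A_N}X_n$ and $r^X(k)=E\{X_0X_k\}$. For each $N\in\mathbb N$ let $X^N=(X^N_n)_{n\in\mathbb Z^d}$ be a real random field (the variables of one field need not be independent, and fields with different $N$ may live on different probability spaces), and for $J>0$ let $X_n^{N,J}=X_n^N\mathbf 1_{\{|X_n^N|\le J\}}-E\{X_n^N\mathbf 1_{\{|X_n^N|\le J\}}\}$. Assume: (H1) For all $N$, $X^N$ is (strictly) stationary, centered, with finite second moments, and $\sum_{k\in\mathbb Z^d}|r^{X^N}(k)|<\infty$. (H2) (i) There is $\rho:\mathbb Z^d\to[0,\infty)$ with $\sum_k\rho(k)<\infty$ and $|r^{X^{N,J}}(k)|\le\rho(k)$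 for all $k\in\mathbb Z^d$, $N\in\mathbb N$, $J>0$. (ii) There is a function $b$ with $\lim_{J\to+\infty}b(J)=0$ such that for all $J>0$, $B\subset\mathbb Z^d$, $N\in\mathbb N$, $$E\{[S_N(B,X^N)-S_N(B,X^{N,J})]^2\}\le b(J)\,\frac{\mathrm{card}(B_N)}{(2N+1)^d}.$$ (H3) For all $J>0$ there is $C(J)<\infty$ such that for all $B\subset\mathbb Z^d$, $N\in\mathbb N$, $$E\{S_N(B,X^{N,J})^4\}\le C(J)\left(\frac{\mathrm{card}(B_N)}{(2N+1)^d}\right)^2.$$ (H4) There are a non-increasing function $h:(0,\infty)\to[0,\infty)$ with $\lim_{x\to+\infty}h(x)=0$ and a real function $g(J,t)$ with $\sup_{t\in\mathbb R}g(J,t)<\infty$ for each $J>0$, such that for all $J>0$, all disjoint nonempty $A,B\subset\mathbb Z^d$, all $N\in\mathbb N$ and $t\in\mathbb R$, $$\left|E\{e^{itS_N(A\cup B,X^{N,J})}\}-E\{e^{itS_N(A,X^{N,J})}\}\,E\{e^{itS_N(B,X^{N,J})}\}\right|\le g(J,t)\,h(\mathrm{dist}(A,B)),$$ where $\mathrm{dist}(A,B)=\inf\{\max_{1\le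 i\le d}|a_i-b_i|: a\in A,\ b\in B\}$. (H5) For all $k\in\mathbb Z^d$ and $J>0$ there are reals $\gamma^J(k)$, $\gamma(k)$ such that $\lim_{N\to+\infty}r^{X^{N,J}}(k)=\gamma^J(k)$ and $\lim_{J\to+\infty}\gamma^J(k)=\gamma(k)$. Then for every asymptotically measurable set $A\subset\mathbb Z^d$ the series $\sigma^2(A)=\sum_{k\in\mathbb Z^d}\gamma(k)H(k;A)$ converges absolutely, $\sigma^2(A)\ge 0$, and $S_N(A,X^N)$ converges weakly, as $N\to\infty$, to $N(0,\sigma^2(A))$ (the unit mass at $0$ if $\sigma^2(A)=0$). -/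

import Mathlib

open MeasureTheory ProbabilityTheory Filter Topology

noncomputable section

/-- The part `A_N = A ∩ [-N, N]^d` of a subset `A` of the lattice `ℤ^d`. -/
def window {d : ℕ} (A : Set (Fin d → ℤ)) (N : ℕ) : Finset (Fin d → ℤ) :=
  open Classical in
  (Finset.Icc (fun _ => -(N : ℤ)) (fun _ => (N : ℤ))).filter (fun n => n ∈ A)

/-- `H_N(n; A) = card (A_N ∩ (n + A_N)) / (2N+1)^d`. -/
def overlapN {d : ℕ} (A : Set (Fin d → ℤ)) (n : Fin d → ℤ) (N : ℕ) : ℝ :=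
  open Classical in
  ((window A N ∩ (window A N).image (fun m => n + m)).card : ℝ) / (2 * (N : ℝ) + 1) ^ d

/-- `A` is asymptotically measurable: `H_N(n; A)` has a limit as `N → ∞`, for every `n`.
The limits then lie in `[0, 1]`; their values `0` and `1` are not excluded. -/
def IsAsymptoticallyMeasurable {d : ℕ} (A : Set (Fin d → ℤ)) : Prop :=
  ∀ n : Fin d → ℤ, ∃ H : ℝ, Tendsto (overlapN A n) atTop (𝓝 H)

/-- `H(n; A) = lim_N H_N(n; A)`; only used for asymptotically measurable `A`. -/
def overlap {d : ℕ} (n : Fin d → ℤ) (A : Set (Fin d → ℤ)) : ℝ :=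
  limUnder atTop (overlapN A n)

/-- The normalized sum `S_N(A, X) = (2N+1)^(-d/2) ∑_{n ∈ A_N} X_n`. -/
def normSum {d : ℕ} {Ω : Type*} (N : ℕ) (A : Set (Fin d → ℤ))
    (X : (Fin d → ℤ) → Ω → ℝ) (ω : Ω) : ℝ :=
  (∑ n ∈ window A N, X n ω) / √((2 * (N : ℝ) + 1) ^ d)

/-- Strict stationarity of a random field on `ℤ^d`: all its translates have the same law, as
random elements of the product space `ℝ^(ℤ^d)`. -/
def IsStationaryField {d : ℕ} {Ω : Type*} [MeasurableSpace Ω] (P : Measure Ω)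
    (X : (Fin d → ℤ) → Ω → ℝ) : Prop :=
  ∀ k : Fin d → ℤ, IdentDistrib (fun ω n => X (n + k) ω) (fun ω n => X n ω) P P

/-- `r^X(k) = E (X_0 X_k)`. -/
def fieldCov {d : ℕ} {Ω : Type*} [MeasurableSpace Ω] (P : Measure Ω)
    (X : (Fin d → ℤ) → Ω → ℝ) (k : Fin d → ℤ) : ℝ :=
  ∫ ω, X 0 ω * X k ω ∂P

/-- The centered truncation `X_n^J = X_n 1_{|X_n| ≤ J} - E (X_n 1_{|X_n| ≤ J})`. -/
def truncField {d : ℕ} {Ω : Type*} [MeasurableSpace Ω] (P : Measure Ω)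
    (X : (Fin d → ℤ) → Ω → ℝ) (J : ℝ) (n : Fin d → ℤ) (ω : Ω) : ℝ :=
  {ω' | |X n ω'| ≤ J}.indicator (X n) ω - ∫ ω₁, {ω' | |X n ω'| ≤ J}.indicator (X n) ω₁ ∂P

/-- The distance of two nonempty subsets of `ℤ^d`, for the maximum norm. -/
def latticeDist {d : ℕ} (A B : Set (Fin d → ℤ)) : ℝ :=
  sInf {r : ℝ | ∃ a ∈ A, ∃ b ∈ B, r = ‖a - b‖}

/-- The characteristic function `E exp(i t Y)` of a real random variable `Y`. -/
def charE {Ω : Type*} [MeasurableSpace Ω] (P : Measure Ω) (Y : Ω → ℝ) (t : ℝ) : ℂ :=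
  ∫ ω, Complex.exp (Complex.I * (t : ℂ) * (Y ω : ℂ)) ∂P

end

/-! Bernstein's method of blocks, cut along a single coordinate, with a number of blocks that stays
fixed while the box grows. Fix the truncation level `J`, slice the box into `M` slabs and remove a
corridor of thickness `w` from each. By summability of `ρ` the corridors carry variance of order `M
w / N`. The remaining blocks are at distance at least `w`, so the characteristic function of their
sum nearly factors (`norm_charE_blocks_sub_prod_le`). A block has density at most `2 / M`, so its
fourth moment is at most of order `1 / M` times its density, and its factor is close to the Gaussian
one with the block's own variance (`norm_charE_sub_exp_le`). These errors add up well because the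
densities sum to at most 1.

No block needs a limiting variance. The block variances sum to nearly the total variance, since the
lost covariances involve corridor sites or lags of norm at least `w` (`abs_integral_sq_sub_sum_le`).
The total variance is `∑ r(k) H_N(k; A)`, which converges by dominated convergence
(`tendsto_integral_normSum_sq`); this is where asymptotic measurability enters.

`norm_charE_normSum_sub_exp_le` collects the errors and `tendsto_charE_normSum` makes them vanish.
The truncation is then removed by an `L²` bound uniform in `N`, and Lévy's continuity theorem
concludes. -/

/-! ### Elementary inequalities for the exponential. -/

lemma norm_cexp_I_mul_sub_le (x : ℝ) :
    ‖Complex.exp (Complex.I * x) - (1 + Complex.I * x - (x : ℂ) ^ 2 / 2)‖ ≤ 4 * |x| ^ 3 := by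
  have hn : ‖Complex.I * (x : ℂ)‖ = |x| := by simp
  rcases le_total |x| 1 with hx | hx
  · have h := Complex.exp_bound (x := Complex.I * x) (by rw [hn]; exact hx) (n := 3) (by norm_num)
    have hs : ∑ m ∈ Finset.range 3, (Complex.I * (x : ℂ)) ^ m / (m.factorial : ℂ)
        = 1 + Complex.I * x - (x : ℂ) ^ 2 / 2 := by
      simp [Finset.sum_range_succ, mul_pow, Nat.factorial]
      ring
    rw [hs, hn] at h
    refine h.trans ?_
    norm_num [Nat.factorial]
    nlinarith [pow_nonneg (abs_nonneg x) 3]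
  · have h1 : ‖Complex.exp (Complex.I * x)‖ = 1 := by
      rw [mul_comm]; exact Complex.norm_exp_ofReal_mul_I x
    have h2 : ‖(x : ℂ) ^ 2 / 2‖ = |x| ^ 2 / 2 := by simp
    have h3 : |x| ≤ |x| ^ 3 := by nlinarith [sq_nonneg (|x|), mul_nonneg (abs_nonneg x) (abs_nonneg x)]
    have h4 : |x| ^ 2 ≤ |x| ^ 3 := by nlinarith [sq_nonneg (|x|)]
    calc _ ≤ ‖Complex.exp (Complex.I * x)‖ + ‖1 + Complex.I * (x : ℂ) - (x : ℂ) ^ 2 / 2‖ :=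
          norm_sub_le _ _
      _ ≤ 1 + (‖1 + Complex.I * (x : ℂ)‖ + ‖(x : ℂ) ^ 2 / 2‖) := by
          rw [h1]; gcongr; exact norm_sub_le _ _
      _ ≤ 1 + ((1 + |x|) + |x| ^ 2 / 2) := by
          rw [h2, ← hn]; gcongr; exact (norm_add_le _ _).trans_eq (by simp)
      _ ≤ _ := by linarith

/-- `|x| ^ 3` is the geometric mean of `c x²` and `x⁴ / c`, so second and fourth moments suffice;
the free parameter `c` makes the second-moment part small. -/
lemma norm_cexp_I_mul_sub_le' (x : ℝ) {c : ℝ} (hc : 0 < c) :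
    ‖Complex.exp (Complex.I * x) - (1 + Complex.I * x - (x : ℂ) ^ 2 / 2)‖
      ≤ 2 * (c * x ^ 2 + x ^ 4 / c) := by
  refine (norm_cexp_I_mul_sub_le x).trans ?_
  have h : c * x ^ 2 + x ^ 4 / c - 2 * |x| ^ 3 = |x| ^ 2 * (c - |x|) ^ 2 / c := by
    have h2 : x ^ 2 = |x| ^ 2 := (sq_abs x).symm
    have h4 : x ^ 4 = |x| ^ 4 := by rw [show (4 : ℕ) = 2 * 2 from rfl, pow_mul, pow_mul, h2]
    rw [h2, h4]; field_simp; ring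
  have : 0 ≤ |x| ^ 2 * (c - |x|) ^ 2 / c := by positivity
  linarith

/-- From `e^x ≥ 1 + x` one gets `e^(-x) ≤ 1 / (1 + x)`, and `(1 + x)(1 - x + x²) = 1 + x³ ≥ 1`. -/
lemma abs_exp_neg_sub_one_sub_le {x : ℝ} (hx : 0 ≤ x) : |Real.exp (-x) - (1 - x)| ≤ x ^ 2 := by
  have h1 : -x + 1 ≤ Real.exp (-x) := Real.add_one_le_exp (-x)
  have h2 : x + 1 ≤ Real.exp x := Real.add_one_le_exp x
  have h3 : Real.exp (-x) * Real.exp x = 1 := by rw [← Real.exp_add]; simp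
  rw [abs_of_nonneg (by linarith)]
  have h5 : Real.exp (-x) * (x + 1) ≤ 1 := 
    (mul_le_mul_of_nonneg_left h2 (Real.exp_pos _).le).trans h3.le
  by_contra! hlt
  nlinarith [pow_nonneg hx 3, Real.exp_pos (-x)]

lemma abs_exp_neg_sub_exp_neg_le {x y : ℝ} (hx : 0 ≤ x) (hy : 0 ≤ y) :
    |Real.exp (-x) - Real.exp (-y)| ≤ |x - y| := by
  wlog h : x ≤ y generalizing x y
  · rw [abs_sub_comm, abs_sub_comm x]; exact this hy hx (le_of_not_ge h)
  have h0 : Real.exp (-y) ≤ Real.exp (-x) := Real.exp_le_exp.2 (by linarith)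
  rw [abs_of_nonneg (by linarith), abs_sub_comm, abs_of_nonneg (by linarith)]
  have h1 : Real.exp (-y) = Real.exp (-x) * Real.exp (-(y - x)) := by
    rw [← Real.exp_add]; ring_nf
  have h2 : -(y - x) + 1 ≤ Real.exp (-(y - x)) := Real.add_one_le_exp _
  have h3 : Real.exp (-x) ≤ 1 := Real.exp_le_one_iff.2 (by linarith)
  rw [h1]
  nlinarith [Real.exp_pos (-x)]

/-! ### Characteristic functions and moments. -/

section CharE

variable {Ω : Type*} [MeasurableSpace Ω] {P : Measure Ω}

lemma charE_eq_charFun {Y : Ω → ℝ} (hY : AEMeasurable Y P) (t : ℝ) :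
    charE P Y t = charFun (P.map Y) t := by
  rw [charFun_apply_real, integral_map hY (by fun_prop), charE]
  congr 1 with ω
  ring_nf

lemma norm_cexp_I_mul_ofReal (t y : ℝ) : ‖Complex.exp (Complex.I * (t : ℂ) * (y : ℂ))‖ = 1 := by
  have := Complex.norm_exp_ofReal_mul_I (t * y)
  rw [← this]; push_cast; ring_nf

lemma integrable_pow_four {Y : Ω → ℝ} (hY : MemLp Y 4 P) :
    Integrable (fun ω => Y ω ^ 4) P := by
  have := hY.integrable_norm_pow (p := 4) (by norm_num)
  simpa [Even.pow_abs (show Even 4 by decide)] using this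

variable [IsProbabilityMeasure P]

lemma integrable_cexp_I_mul {Y : Ω → ℝ} (hY : AEMeasurable Y P) (t : ℝ) :
    Integrable (fun ω => Complex.exp (Complex.I * (t : ℂ) * (Y ω : ℂ))) P := by
  refine Integrable.of_bound (C := 1) ?_ (.of_forall fun ω => (norm_cexp_I_mul_ofReal t _).le)
  exact AEMeasurable.aestronglyMeasurable (by fun_prop)

lemma norm_charE_le_one (Y : Ω → ℝ) (t : ℝ) : ‖charE P Y t‖ ≤ 1 := by
  have := norm_integral_le_of_norm_le_const (μ := P)
    (f := fun ω => Complex.exp (Complex.I * (t : ℂ) * (Y ω : ℂ))) (C := 1)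
    (.of_forall fun ω => (norm_cexp_I_mul_ofReal t _).le)
  simpa [charE] using this

/-- The square of the mean is at most the mean of the square. -/
lemma sq_integral_le_integral_sq {Z : Ω → ℝ} (hZ : MemLp Z 2 P) :
    (∫ ω, Z ω ∂P) ^ 2 ≤ ∫ ω, Z ω ^ 2 ∂P := by
  have h := variance_eq_sub hZ
  have h0 := variance_nonneg Z P
  simp only [Pi.pow_apply] at h
  linarith

/-- Serves twice: to discard the corridors and to remove the truncation. -/
lemma norm_charE_sub_charE_le {U V : Ω → ℝ} (hU : MemLp U 2 P) (hV : MemLp V 2 P) (t : ℝ) :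
    ‖charE P U t - charE P V t‖ ≤ |t| * √(∫ ω, (U ω - V ω) ^ 2 ∂P) := by
  have hUV : MemLp (fun ω => U ω - V ω) 2 P := hU.sub hV
  have hint : Integrable (fun ω => |U ω - V ω|) P := (hUV.integrable (by norm_num)).abs
  have h1 : ∫ ω, |U ω - V ω| ∂P ≤ √(∫ ω, (U ω - V ω) ^ 2 ∂P) := by
    apply Real.le_sqrt_of_sq_le
    have := sq_integral_le_integral_sq (P := P) hUV.abs
    simpa using this
  have h2 : ∀ ω, ‖Complex.exp (Complex.I * (t : ℂ) * (U ω : ℂ))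
      - Complex.exp (Complex.I * (t : ℂ) * (V ω : ℂ))‖ ≤ |t| * |U ω - V ω| := by
    intro ω
    have e : Complex.exp (Complex.I * (t : ℂ) * (U ω : ℂ))
        - Complex.exp (Complex.I * (t : ℂ) * (V ω : ℂ))
        = Complex.exp (Complex.I * (t : ℂ) * (V ω : ℂ))
          * (Complex.exp (Complex.I * ((t * (U ω - V ω) : ℝ) : ℂ)) - 1) := by
      rw [mul_sub, ← Complex.exp_add]; push_cast; ring_nf
    rw [e, norm_mul, norm_cexp_I_mul_ofReal, one_mul, ← abs_mul]
    exact Real.norm_exp_I_mul_ofReal_sub_one_le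
  rw [charE, charE, ← integral_sub (integrable_cexp_I_mul hU.aemeasurable t)
    (integrable_cexp_I_mul hV.aemeasurable t)]
  calc _ ≤ ∫ ω, |t| * |U ω - V ω| ∂P :=
        norm_integral_le_of_norm_le (hint.const_mul _) (.of_forall h2)
    _ = |t| * ∫ ω, |U ω - V ω| ∂P := integral_const_mul _ _
    _ ≤ _ := by gcongr

lemma memLp_two_of_memLp_four {Y : Ω → ℝ} (hY : MemLp Y 4 P) : MemLp Y 2 P :=
  hY.mono_exponent (by norm_num)

/-- Gaussian approximation of the characteristic function of a centered variable, in terms of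
its second and fourth moments. -/
lemma norm_charE_sub_exp_le {Y : Ω → ℝ} (hY : MemLp Y 4 P) (h0 : ∫ ω, Y ω ∂P = 0) (t : ℝ)
    {c : ℝ} (hc : 0 < c) :
    ‖charE P Y t - (Real.exp (-(t ^ 2 / 2 * ∫ ω, Y ω ^ 2 ∂P)) : ℂ)‖
      ≤ 2 * (c * t ^ 2 * ∫ ω, Y ω ^ 2 ∂P) + 2 * (t ^ 4 / c * ∫ ω, Y ω ^ 4 ∂P)
        + (t ^ 2 / 2 * ∫ ω, Y ω ^ 2 ∂P) ^ 2 := by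
  have hY2 := memLp_two_of_memLp_four hY
  have i1 : Integrable Y P := hY2.integrable (by norm_num)
  have i2 : Integrable (fun ω => Y ω ^ 2) P := hY2.integrable_sq
  have i4 := integrable_pow_four hY
  set v := ∫ ω, Y ω ^ 2 ∂P with hv
  set m := ∫ ω, Y ω ^ 4 ∂P with hm
  have hv0 : 0 ≤ v := integral_nonneg fun ω => by positivity
  have hI1 : Integrable (fun ω => Complex.I * ((t * Y ω : ℝ) : ℂ)) P :=
    ((i1.const_mul t).ofReal).const_mul _
  have hI2 : Integrable (fun ω => (((t * Y ω) ^ 2 / 2 : ℝ) : ℂ)) P := by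
    have : Integrable (fun ω => (t * Y ω) ^ 2 / 2) P := by
      simpa [mul_pow] using (i2.const_mul (t ^ 2)).div_const 2
    exact this.ofReal
  have hI12 : Integrable (fun ω => 1 + Complex.I * ((t * Y ω : ℝ) : ℂ)) P :=
    (integrable_const _).add hI1
  -- Centering kills the linear Taylor term, so the difference is the mean of the pointwise
  -- remainder.
  have hmain : charE P Y t - ((1 - t ^ 2 / 2 * v : ℝ) : ℂ)
      = ∫ ω, (Complex.exp (Complex.I * ((t * Y ω : ℝ) : ℂ)) -
        (1 + Complex.I * ((t * Y ω : ℝ) : ℂ) - ((t * Y ω : ℝ) : ℂ) ^ 2 / 2)) ∂P := by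
    have e1 : ∫ ω, (1 + Complex.I * ((t * Y ω : ℝ) : ℂ) - (((t * Y ω) ^ 2 / 2 : ℝ) : ℂ)) ∂P
        = ((1 - t ^ 2 / 2 * v : ℝ) : ℂ) := by
      rw [integral_sub hI12 hI2, integral_add (integrable_const _) hI1, integral_const_mul,
        integral_complex_ofReal, integral_complex_ofReal, integral_const_mul, h0]
      have : ∫ ω, (t * Y ω) ^ 2 / 2 ∂P = t ^ 2 / 2 * v := by
        rw [hv, ← integral_const_mul]; congr 1 with ω; ring
      rw [this]; simp
    have e2 : charE P Y t = ∫ ω, Complex.exp (Complex.I * ((t * Y ω : ℝ) : ℂ)) ∂P := by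
      rw [charE]; congr 1 with ω; push_cast; ring_nf
    have i0 : Integrable (fun ω => Complex.exp (Complex.I * ((t * Y ω : ℝ) : ℂ))) P := by
      have := integrable_cexp_I_mul (P := P) hY.aemeasurable t
      refine this.congr (.of_forall fun ω => ?_)
      simp only; push_cast; ring_nf
    rw [e2, ← e1]
    refine (integral_sub i0 (hI12.sub hI2)).symm.trans ?_
    congr 1 with ω
    simp only [Pi.sub_apply]
    push_cast; ring_nf
  have hb : ‖charE P Y t - ((1 - t ^ 2 / 2 * v : ℝ) : ℂ)‖
      ≤ 2 * (c * t ^ 2 * v) + 2 * (t ^ 4 / c * m) := by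
    rw [hmain]
    calc _ ≤ ∫ ω, (2 * (c * t ^ 2 * Y ω ^ 2) + 2 * (t ^ 4 / c * Y ω ^ 4)) ∂P := by
          refine norm_integral_le_of_norm_le
            (((i2.const_mul _).const_mul _).add ((i4.const_mul _).const_mul _))
            (.of_forall fun ω => (norm_cexp_I_mul_sub_le' (t * Y ω) hc).trans_eq ?_)
          ring
      _ = _ := by
          rw [integral_add ((i2.const_mul _).const_mul _) ((i4.const_mul _).const_mul _)]
          simp only [integral_const_mul]
          rfl
  have he := abs_exp_neg_sub_one_sub_le (x := t ^ 2 / 2 * v) (by positivity)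
  have he' : ‖((1 - t ^ 2 / 2 * v : ℝ) : ℂ) - (Real.exp (-(t ^ 2 / 2 * v)) : ℂ)‖
      ≤ (t ^ 2 / 2 * v) ^ 2 := by
    rw [← Complex.ofReal_sub, Complex.norm_real, Real.norm_eq_abs, abs_sub_comm]; exact he
  calc _ ≤ _ := norm_sub_le_norm_sub_add_norm_sub _ ((1 - t ^ 2 / 2 * v : ℝ) : ℂ) _
    _ ≤ _ := add_le_add hb he'

end CharE

/-- Telescoping: factors are exchanged one at a time, and those left in place have norm at most 1.
-/
lemma norm_prod_sub_prod_le_sum {m : ℕ} {a b : ℕ → ℂ} (ha : ∀ j, ‖a j‖ ≤ 1) (hb : ∀ j, ‖b j‖ ≤ 1) :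
    ‖∏ j ∈ Finset.range m, a j - ∏ j ∈ Finset.range m, b j‖
      ≤ ∑ j ∈ Finset.range m, ‖a j - b j‖ := by
  induction m with
  | zero => simp
  | succ m ih =>
    rw [Finset.prod_range_succ, Finset.prod_range_succ, Finset.sum_range_succ]
    have e : (∏ j ∈ Finset.range m, a j) * a m - (∏ j ∈ Finset.range m, b j) * b m
      = (∏ j ∈ Finset.range m, a j - ∏ j ∈ Finset.range m, b j) * a m
        + (∏ j ∈ Finset.range m, b j) * (a m - b m) := by ring
    have hB : ‖∏ j ∈ Finset.range m, b j‖ ≤ 1 := by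
      rw [norm_prod]; exact Finset.prod_le_one (fun _ _ => norm_nonneg _) fun j _ => hb j
    rw [e]
    refine (norm_add_le _ _).trans ?_
    rw [norm_mul, norm_mul]
    have := mul_le_of_le_one_right (norm_nonneg
      (∏ j ∈ Finset.range m, a j - ∏ j ∈ Finset.range m, b j)) (ha m)
    have := mul_le_of_le_one_left (norm_nonneg (a m - b m)) hB
    linarith

/-! ### Counting lattice sites. -/

section Lattice

variable {d : ℕ}

lemma mem_window {A : Set (Fin d → ℤ)} {N : ℕ} {n : Fin d → ℤ} :
    n ∈ window A N ↔ (∀ i, -(N : ℤ) ≤ n i ∧ n i ≤ N) ∧ n ∈ A := by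
  simp [window, Pi.le_def, forall_and]

/-- The proportion of sites of the box `[-N, N]^d` which lie in `B`. -/
noncomputable def windowDensity (B : Set (Fin d → ℤ)) (N : ℕ) : ℝ :=
  ((window B N).card : ℝ) / (2 * (N : ℝ) + 1) ^ d

lemma windowDensity_nonneg (B : Set (Fin d → ℤ)) (N : ℕ) : 0 ≤ windowDensity B N := by
  unfold windowDensity; positivity

lemma card_window_slab_le (i : Fin d) (B : Set (Fin d → ℤ)) (N : ℕ) (T : Finset ℤ)
    (hT : ∀ n ∈ window B N, n i ∈ T) :
    (window B N).card ≤ T.card * (2 * N + 1) ^ (d - 1) := by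
  classical
  have hsub : window B N ⊆ Fintype.piFinset
      (Function.update (fun _ : Fin d => Finset.Icc (-(N : ℤ)) N) i T) := by
    intro n hn
    rw [Fintype.mem_piFinset]
    intro j
    by_cases hj : j = i
    · subst hj; simpa using hT n hn
    · simpa [Function.update_of_ne hj] using (mem_window.1 hn).1 j
  refine (Finset.card_le_card hsub).trans_eq ?_
  rw [Fintype.card_piFinset, ← Finset.mul_prod_erase _ _ (Finset.mem_univ i),
    Finset.prod_congr rfl (g := fun _ => 2 * N + 1)]
  · simp
  · intro j hj
    rw [Function.update_of_ne (Finset.ne_of_mem_erase hj), Int.card_Icc]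
    omega

/-- The other `d - 1` coordinates cancel against the normalization, so cutting in one direction
already makes densities small in every dimension. -/
lemma windowDensity_slab_le (i : Fin d) (B : Set (Fin d → ℤ)) (N : ℕ) (T : Finset ℤ)
    (hT : ∀ n ∈ window B N, n i ∈ T) :
    windowDensity B N ≤ T.card / (2 * (N : ℝ) + 1) := by
  have h := card_window_slab_le i B N T hT
  have hd : d = (d - 1) + 1 := by have := i.pos; omega
  rw [windowDensity, div_le_div_iff₀ (by positivity) (by positivity)]
  have h' : ((window B N).card : ℝ) ≤ T.card * (2 * (N : ℝ) + 1) ^ (d - 1) := by exact_mod_cast h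
  calc _ ≤ T.card * (2 * (N : ℝ) + 1) ^ (d - 1) * (2 * (N : ℝ) + 1) := by gcongr
    _ = T.card * (2 * (N : ℝ) + 1) ^ d := by conv_rhs => rw [hd, pow_succ]
                                             ring

lemma card_window_le (B : Set (Fin d → ℤ)) (N : ℕ) : (window B N).card ≤ (2 * N + 1) ^ d := by
  classical
  have hsub : window B N ⊆ Fintype.piFinset (fun _ : Fin d => Finset.Icc (-(N : ℤ)) N) := by
    intro n hn
    rw [Fintype.mem_piFinset]
    intro j
    simpa using (mem_window.1 hn).1 j
  refine (Finset.card_le_card hsub).trans_eq ?_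
  rw [Fintype.card_piFinset]
  simp only [Int.card_Icc, Finset.prod_const, Finset.card_univ, Fintype.card_fin]
  congr 1; omega

lemma windowDensity_le_one (B : Set (Fin d → ℤ)) (N : ℕ) : windowDensity B N ≤ 1 := by
  rw [windowDensity, div_le_one (by positivity)]
  exact_mod_cast card_window_le B N

lemma overlapN_nonneg (A : Set (Fin d → ℤ)) (k : Fin d → ℤ) (N : ℕ) : 0 ≤ overlapN A k N := by
  unfold overlapN; positivity

lemma overlapN_le_one (A : Set (Fin d → ℤ)) (k : Fin d → ℤ) (N : ℕ) : overlapN A k N ≤ 1 := by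
  refine le_trans ?_ (windowDensity_le_one A N)
  unfold overlapN windowDensity
  gcongr
  exact Finset.inter_subset_left

lemma le_latticeDist {A B : Set (Fin d → ℤ)} (hA : A.Nonempty) (hB : B.Nonempty) {w : ℝ}
    (h : ∀ a ∈ A, ∀ b ∈ B, w ≤ ‖a - b‖) : w ≤ latticeDist A B := by
  obtain ⟨a, ha⟩ := hA
  obtain ⟨b, hb⟩ := hB
  refine le_csInf ⟨_, a, ha, b, hb, rfl⟩ ?_
  rintro r ⟨a, ha, b, hb, rfl⟩
  exact h a ha b hb

/-! ### Double sums of a covariance function -/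

section DoubleSum

variable {G : Type*} [AddCommGroup G] {r ρ : G → ℝ}

lemma sum_translate_le_tsum (hρ : ∀ k, 0 ≤ ρ k) (hs : Summable ρ) (S : Finset G) (m : G) :
    ∑ n ∈ S, ρ (n - m) ≤ ∑' k, ρ k := by
  classical
  rw [← Finset.sum_image (f := ρ) (s := S) (g := fun n => n - m) (by intro a _ b _; simp)]
  exact hs.sum_le_tsum _ fun k _ => hρ k

lemma sum_translate_le_tsum' (hρ : ∀ k, 0 ≤ ρ k) (hs : Summable ρ) (S : Finset G) (n : G) :
    ∑ m ∈ S, ρ (n - m) ≤ ∑' k, ρ k := by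
  classical
  rw [← Finset.sum_image (f := ρ) (s := S) (g := fun m => n - m) (by intro a _ b _; simp)]
  exact hs.sum_le_tsum _ fun k _ => hρ k

lemma sum_sum_le_card_mul_tsum (hρ : ∀ k, 0 ≤ ρ k) (hs : Summable ρ) (S T : Finset G) :
    ∑ m ∈ S, ∑ n ∈ T, ρ (n - m) ≤ S.card * ∑' k, ρ k := by
  rw [← nsmul_eq_mul]
  exact Finset.sum_le_card_nsmul _ _ _ fun m _ => sum_translate_le_tsum hρ hs T m

/-- The double sum over a set, compared with the double sums over far apart pieces of it. -/
lemma abs_sum_sum_sub_sum_fiber_le [DecidableEq G] (hρ : ∀ k, 0 ≤ ρ k) (hs : Summable ρ)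
    (hr : ∀ k, |r k| ≤ ρ k) {W U : Finset G} (hU : U ⊆ W) (β : G → ℕ) (M : ℕ)
    (hβ : ∀ n ∈ U, β n < M) (far : Set G)
    (hfar : ∀ m ∈ U, ∀ n ∈ U, β n ≠ β m → n - m ∈ far) :
    |∑ m ∈ W, ∑ n ∈ W, r (n - m)
        - ∑ j ∈ Finset.range M, ∑ m ∈ U with β m = j, ∑ n ∈ U with β n = j, r (n - m)|
      ≤ 2 * ((W \ U).card * ∑' k, ρ k) + W.card * ∑' k, far.indicator ρ k := by
  have e1 : ∑ j ∈ Finset.range M, ∑ m ∈ U with β m = j, ∑ n ∈ U with β n = j, r (n - m)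
      = ∑ m ∈ U, ∑ n ∈ U with β n = β m, r (n - m) := by
    rw [← Finset.sum_fiberwise_of_maps_to (s := U) (t := Finset.range M) (g := β)
      (fun n hn => Finset.mem_range.2 (hβ n hn))]
    refine Finset.sum_congr rfl fun j _ => Finset.sum_congr rfl fun m hm => ?_
    rw [(Finset.mem_filter.1 hm).2]
  have hs' : Summable (far.indicator ρ) := hs.indicator far
  have hρ' : ∀ k, 0 ≤ far.indicator ρ k := fun k => Set.indicator_nonneg (fun k _ => hρ k) k
  -- Pairs are split by whether the first site is discarded, only the second is, or both are kept,
  -- in different or in equal fibres; only the last class survives.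
  have e2 : ∑ m ∈ W, ∑ n ∈ W, r (n - m) = ∑ m ∈ W \ U, ∑ n ∈ W, r (n - m)
      + (∑ m ∈ U, ∑ n ∈ W \ U, r (n - m)
        + (∑ m ∈ U, ∑ n ∈ U with β n ≠ β m, r (n - m)
          + ∑ m ∈ U, ∑ n ∈ U with β n = β m, r (n - m))) := by
    rw [← Finset.sum_sdiff hU, ← Finset.sum_add_distrib, ← Finset.sum_add_distrib]
    congr 1
    refine Finset.sum_congr rfl fun m _ => ?_
    rw [← Finset.sum_sdiff hU, ← Finset.sum_filter_add_sum_filter_not U (fun n => β n = β m)]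
    ring
  have b1 : |∑ m ∈ W \ U, ∑ n ∈ W, r (n - m)| ≤ (W \ U).card * ∑' k, ρ k := by
    refine le_trans ?_ (sum_sum_le_card_mul_tsum hρ hs _ W)
    refine (Finset.abs_sum_le_sum_abs _ _).trans (Finset.sum_le_sum fun m _ => ?_)
    exact (Finset.abs_sum_le_sum_abs _ _).trans (Finset.sum_le_sum fun n _ => hr _)
  have b2 : |∑ m ∈ U, ∑ n ∈ W \ U, r (n - m)| ≤ (W \ U).card * ∑' k, ρ k := by
    rw [Finset.sum_comm]
    refine (Finset.abs_sum_le_sum_abs _ _).trans ?_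
    rw [← nsmul_eq_mul]
    refine Finset.sum_le_card_nsmul _ _ _ fun n _ => ?_
    refine le_trans ?_ (sum_translate_le_tsum' hρ hs U n)
    exact (Finset.abs_sum_le_sum_abs _ _).trans (Finset.sum_le_sum fun m _ => hr _)
  have b3 : |∑ m ∈ U, ∑ n ∈ U with β n ≠ β m, r (n - m)|
      ≤ W.card * ∑' k, far.indicator ρ k := by
    have : ∑ m ∈ U, ∑ n ∈ U, far.indicator ρ (n - m) ≤ W.card * ∑' k, far.indicator ρ k := by
      refine (sum_sum_le_card_mul_tsum hρ' hs' U U).trans ?_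
      have : 0 ≤ ∑' k, far.indicator ρ k := tsum_nonneg hρ'
      gcongr
    refine le_trans ?_ this
    refine (Finset.abs_sum_le_sum_abs _ _).trans (Finset.sum_le_sum fun m hm => ?_)
    refine (Finset.abs_sum_le_sum_abs _ _).trans ?_
    refine le_trans (Finset.sum_le_sum fun n hn => ?_)
      (Finset.sum_le_sum_of_subset_of_nonneg (Finset.filter_subset _ _) fun n _ _ => hρ' _)
    rw [Finset.mem_filter] at hn
    rw [Set.indicator_of_mem (hfar m hm n hn.1 hn.2)]
    exact hr _
  rw [e1, e2]
  rw [abs_le] at *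
  constructor <;> linarith [b1.1, b1.2, b2.1, b2.2, b3.1, b3.2]

end DoubleSum

/-- Pairs are grouped by their difference `k`; the pairs `(n - k, n)` correspond to the sites `n` of
the overlap. -/
lemma sum_sum_window_eq_tsum (r : (Fin d → ℤ) → ℝ) (A : Set (Fin d → ℤ)) (N : ℕ) :
    (∑ m ∈ window A N, ∑ n ∈ window A N, r (n - m)) / (2 * (N : ℝ) + 1) ^ d
      = ∑' k, r k * overlapN A k N := by
  classical
  have hov : ∀ k, overlapN A k N
      = (((window A N ×ˢ window A N).filter (fun p => p.2 - p.1 = k)).card : ℝ)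
        / (2 * (N : ℝ) + 1) ^ d := by
    intro k
    unfold overlapN
    congr 2
    refine Finset.card_bij' (fun n _ => (n - k, n)) (fun p _ => p.2) ?_ ?_ ?_ ?_
    · intro n hn
      simp only [Finset.mem_inter, Finset.mem_image] at hn
      obtain ⟨h1, m, h2, rfl⟩ := hn
      simp [h1, h2]
    · intro p hp
      simp only [Finset.mem_filter, Finset.mem_product] at hp
      simp only [Finset.mem_inter, Finset.mem_image]
      exact ⟨hp.1.2, p.1, hp.1.1, by rw [← hp.2]; abel⟩
    · intro n _; rfl
    · intro p hp
      simp only [Finset.mem_filter, Finset.mem_product] at hp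
      ext1
      · simp [← hp.2]
      · rfl
  rw [tsum_eq_sum (s := (window A N ×ˢ window A N).image (fun p => p.2 - p.1)),
    ← Finset.sum_product' (f := fun m n => r (n - m)),
    Finset.sum_comp r (fun p : (Fin d → ℤ) × (Fin d → ℤ) => p.2 - p.1), Finset.sum_div]
  · refine Finset.sum_congr rfl fun k _ => ?_
    rw [hov, nsmul_eq_mul]; ring
  · intro k hk
    rw [hov, Finset.filter_eq_empty_iff.2]
    · simp
    · intro p hp h
      exact hk (Finset.mem_image.2 ⟨p, hp, h⟩)

/-! ### Blocks and corridors -/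

/-- The coordinate `i`, counted from the face of the box `[-N, N]^d`. -/
def depth (i : Fin d) (N : ℕ) (n : Fin d → ℤ) : ℕ := (n i + N).toNat

/-- The sites of `A` in the `j`-th slab of thickness `L`, without its corridor of thickness `w`. -/
def block (A : Set (Fin d → ℤ)) (i : Fin d) (N L w j : ℕ) : Set (Fin d → ℤ) :=
  {n | n ∈ A ∧ depth i N n / L = j ∧ w ≤ depth i N n % L}

/-- The sites of `A` outside the corridors, in the first `M` slabs. -/
def blocks (A : Set (Fin d → ℤ)) (i : Fin d) (N L w M : ℕ) : Set (Fin d → ℤ) :=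
  {n | n ∈ A ∧ depth i N n / L < M ∧ w ≤ depth i N n % L}

/-- The sites of `A` in the corridors. -/
def corridor (A : Set (Fin d → ℤ)) (i : Fin d) (N L w : ℕ) : Set (Fin d → ℤ) :=
  {n | n ∈ A ∧ depth i N n % L < w}

variable {A : Set (Fin d → ℤ)} {i : Fin d} {N L w M : ℕ}

lemma blocks_succ (A : Set (Fin d → ℤ)) (i : Fin d) (N L w m : ℕ) :
    blocks A i N L w (m + 1) = blocks A i N L w m ∪ block A i N L w m := by
  ext n
  simp only [blocks, block, Set.mem_union, Set.mem_ofPred_eq, Nat.lt_succ_iff_lt_or_eq]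
  tauto

/-- The corridor lies at the start of each slab, so a kept site of a later slab is at least `w`
deeper than anything in an earlier one. -/
lemma le_norm_sub_of_depth {m n : Fin d → ℤ} (hw : depth i N m / L < depth i N n / L)
    (hn : w ≤ depth i N n % L) : (w : ℝ) ≤ ‖n - m‖ := by
  have h1 : depth i N m + w ≤ depth i N n := by
    rcases Nat.eq_zero_or_pos L with rfl | hL
    · simp at hw
    have := Nat.div_add_mod (depth i N n) L
    have h2 : depth i N m < L * (depth i N m / L + 1) := Nat.lt_mul_div_succ _ hL
    have h3 : L * (depth i N m / L + 1) ≤ L * (depth i N n / L) := Nat.mul_le_mul_left _ hw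
    omega
  have h2 : (w : ℤ) ≤ |(n - m) i| := by
    rw [Pi.sub_apply]
    -- The truncation in `depth` is harmless for sites outside the box: a positive depth of `n` is
    -- exactly `n i + N`, while that of `m` is at least `m i + N`.
    rcases Nat.eq_zero_or_pos w with rfl | hw0
    · exact abs_nonneg _
    refine le_trans ?_ (le_abs_self _)
    unfold depth at *
    omega
  refine le_trans ?_ (norm_le_pi_norm (n - m) i)
  rw [Int.norm_eq_abs]
  exact_mod_cast h2

lemma le_norm_sub_of_mem_blocks {m n : Fin d → ℤ} (hm : m ∈ blocks A i N L w M)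
    (hn : n ∈ blocks A i N L w M) (h : depth i N n / L ≠ depth i N m / L) :
    (w : ℝ) ≤ ‖n - m‖ := by
  rcases lt_or_gt_of_ne h with h | h
  · rw [norm_sub_rev]; exact le_norm_sub_of_depth h hm.2.2
  · exact le_norm_sub_of_depth h hn.2.2

lemma depth_lt_of_mem_window {n : Fin d → ℤ} (hn : n ∈ window A N) : depth i N n < 2 * N + 1 := by
  have := (mem_window.1 hn).1 i
  unfold depth; omega

/-- `M` slabs cover the box, so a site of `A` in the box can miss `blocks` only by lying in a
corridor. -/
lemma window_corridor (hLM : 2 * N + 1 ≤ L * M) :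
    window (corridor A i N L w) N = window A N \ window (blocks A i N L w M) N := by
  ext n
  have key : n ∈ window A N → depth i N n / L < M := fun hn =>
    Nat.div_lt_of_lt_mul ((depth_lt_of_mem_window hn).trans_le hLM)
  have h0 : n ∈ window A N ↔ (∀ i, -(N : ℤ) ≤ n i ∧ n i ≤ N) ∧ n ∈ A := mem_window
  rw [Finset.mem_sdiff, mem_window, mem_window, mem_window]
  rw [h0] at key
  simp only [corridor, blocks, Set.mem_ofPred_eq]
  constructor
  · rintro ⟨h1, h2, h3⟩
    exact ⟨⟨h1, h2⟩, fun h => by omega⟩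
  · rintro ⟨⟨h1, h2⟩, h3⟩
    refine ⟨h1, h2, ?_⟩
    by_contra! hlt
    exact h3 ⟨h1, h2, key ⟨h1, h2⟩, hlt⟩

lemma window_blocks_subset : window (blocks A i N L w M) N ⊆ window A N := by
  intro n hn
  rw [mem_window] at *
  exact ⟨hn.1, hn.2.1⟩

lemma window_block {j : ℕ} (hj : j < M) :
    window (block A i N L w j) N
      = (window (blocks A i N L w M) N).filter (fun n => depth i N n / L = j) := by
  ext n
  rw [Finset.mem_filter, mem_window, mem_window]
  simp only [block, blocks, Set.mem_ofPred_eq]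
  constructor
  · rintro ⟨h1, h2, h3, h4⟩
    exact ⟨⟨h1, h2, h3 ▸ hj, h4⟩, h3⟩
  · rintro ⟨⟨h1, h2, h3, h4⟩, h5⟩
    exact ⟨h1, h2, h5, h4⟩

lemma windowDensity_block_le (A : Set (Fin d → ℤ)) (i : Fin d) (N L w j : ℕ) (hL : 0 < L) :
    windowDensity (block A i N L w j) N ≤ L / (2 * (N : ℝ) + 1) := by
  refine (windowDensity_slab_le i _ N (Finset.Ico ((j * L : ℕ) - N : ℤ) ((j * L : ℕ) - N + L))
    ?_).trans_eq ?_
  · intro n hn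
    obtain ⟨h1, -, h2, -⟩ := mem_window.1 hn
    have h1 := h1 i
    have h3 := Nat.div_add_mod (depth i N n) L
    have h4 := Nat.mod_lt (depth i N n) hL
    rw [h2, mul_comm] at h3
    rw [Finset.mem_Ico]
    have h5 : (depth i N n : ℤ) = n i + N := by unfold depth; omega
    omega
  · rw [Int.card_Ico]; simp

lemma windowDensity_corridor_le (A : Set (Fin d → ℤ)) (i : Fin d) (hLM : 2 * N + 1 ≤ L * M) :
    windowDensity (corridor A i N L w) N ≤ M * w / (2 * (N : ℝ) + 1) := by
  classical
  refine (windowDensity_slab_le i _ N ((Finset.range M).biUnion fun j =>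
    Finset.Ico ((j * L : ℕ) - N : ℤ) ((j * L : ℕ) - N + w)) ?_).trans ?_
  · intro n hn
    obtain ⟨h1, h0, h2⟩ := mem_window.1 hn
    have hn' : n ∈ window A N := mem_window.2 ⟨h1, h0⟩
    have h1 := h1 i
    have h3 := Nat.div_add_mod (depth i N n) L
    rw [mul_comm] at h3
    have h5 : (depth i N n : ℤ) = n i + N := by unfold depth; omega
    rw [Finset.mem_biUnion]
    refine ⟨depth i N n / L, Finset.mem_range.2
      (Nat.div_lt_of_lt_mul ((depth_lt_of_mem_window hn').trans_le hLM)), ?_⟩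
    rw [Finset.mem_Ico]
    omega
  · gcongr
    have : ((Finset.range M).biUnion fun j =>
        Finset.Ico ((j * L : ℕ) - N : ℤ) ((j * L : ℕ) - N + w)).card ≤ M * w := by
      refine Finset.card_biUnion_le.trans ((Finset.sum_le_card_nsmul _ _ w ?_).trans_eq (by simp))
      intro j _
      rw [Int.card_Ico]; simp
    exact_mod_cast this

lemma sum_windowDensity_block_le (A : Set (Fin d → ℤ)) (i : Fin d) (N L w M : ℕ) :
    ∑ j ∈ Finset.range M, windowDensity (block A i N L w j) N ≤ 1 := by
  have h : ∑ j ∈ Finset.range M, (window (block A i N L w j) N).card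
      = (window (blocks A i N L w M) N).card := by
    rw [Finset.card_eq_sum_card_fiberwise (f := fun n => depth i N n / L) (t := Finset.range M)]
    · exact Finset.sum_congr rfl fun j hj => by rw [window_block (Finset.mem_range.1 hj)]
    · intro n hn
      exact Finset.mem_coe.2 (Finset.mem_range.2 (mem_window.1 hn).2.2.1)
  refine le_trans (le_of_eq ?_) (windowDensity_le_one (blocks A i N L w M) N)
  unfold windowDensity
  rw [← h, ← Finset.sum_div]; push_cast; rfl

end Lattice

/-! ### Normalized sums and the block estimate. -/

lemma normSum_sub_normSum_blocks {d : ℕ} {Ω : Type*} {Y : (Fin d → ℤ) → Ω → ℝ} {N L w M : ℕ}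
    (hLM : 2 * N + 1 ≤ L * M) (A : Set (Fin d → ℤ)) (i : Fin d) (ω : Ω) :
    normSum N A Y ω - normSum N (blocks A i N L w M) Y ω = normSum N (corridor A i N L w) Y ω := by
  classical
  rw [normSum, normSum, normSum, window_corridor hLM, ← sub_div,
    ← Finset.sum_sdiff (window_blocks_subset (A := A) (i := i) (N := N) (L := L) (w := w) (M := M)),
    add_sub_cancel_right]

section NormSum

variable {d : ℕ} {Ω : Type*} [MeasurableSpace Ω] {P : Measure Ω}
  {Y : (Fin d → ℤ) → Ω → ℝ} {N : ℕ}

lemma memLp_normSum {p : ENNReal} (hY : ∀ n, MemLp (Y n) p P) (N : ℕ) (B : Set (Fin d → ℤ)) :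
    MemLp (normSum N B Y) p P := by
  have h := memLp_finsetSum (window B N) (f := Y) (p := p) (μ := P) fun n _ => hY n
  have := h.const_mul (√((2 * (N : ℝ) + 1) ^ d))⁻¹
  refine this.congr_norm ?_ ?_
  · have h1 := this.1
    have e : (fun ω => (√((2 * (N : ℝ) + 1) ^ d))⁻¹ * ∑ n ∈ window B N, Y n ω)
        = normSum N B Y := by
      ext ω; rw [normSum]; field_simp
    rwa [← e]
  · filter_upwards with ω
    rw [normSum, div_eq_inv_mul]

lemma integral_normSum_eq_zero (hY : ∀ n, Integrable (Y n) P) (h0 : ∀ n, ∫ ω, Y n ω ∂P = 0)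
    (B : Set (Fin d → ℤ)) : ∫ ω, normSum N B Y ω ∂P = 0 := by
  unfold normSum
  rw [integral_div, integral_finsetSum _ fun n _ => hY n]
  simp [h0]

lemma integral_normSum_sq (hY : ∀ n, MemLp (Y n) 2 P) {r : (Fin d → ℤ) → ℝ}
    (hr : ∀ m n, ∫ ω, Y m ω * Y n ω ∂P = r (n - m)) (B : Set (Fin d → ℤ)) :
    ∫ ω, normSum N B Y ω ^ 2 ∂P
      = (∑ m ∈ window B N, ∑ n ∈ window B N, r (n - m)) / (2 * (N : ℝ) + 1) ^ d := by
  have hi : ∀ m n, Integrable (fun ω => Y m ω * Y n ω) P := fun m n =>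
    (hY m).integrable_mul (hY n)
  have e : ∀ ω, normSum N B Y ω ^ 2
      = (∑ m ∈ window B N, ∑ n ∈ window B N, Y m ω * Y n ω) / (2 * (N : ℝ) + 1) ^ d := by
    intro ω
    rw [normSum, div_pow, Real.sq_sqrt (by positivity), sq, Finset.sum_mul_sum]
  simp_rw [e]
  rw [integral_div, integral_finsetSum _ fun m _ => integrable_finsetSum _ fun n _ => hi m n]
  congr 1
  refine Finset.sum_congr rfl fun m _ => ?_
  rw [integral_finsetSum _ fun n _ => hi m n]
  exact Finset.sum_congr rfl fun n _ => hr m n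

lemma integral_normSum_sq_le (hY : ∀ n, MemLp (Y n) 2 P) {r ρ : (Fin d → ℤ) → ℝ}
    (hr : ∀ m n, ∫ ω, Y m ω * Y n ω ∂P = r (n - m)) (hρ : ∀ k, 0 ≤ ρ k) (hs : Summable ρ)
    (hrρ : ∀ k, |r k| ≤ ρ k) (B : Set (Fin d → ℤ)) :
    ∫ ω, normSum N B Y ω ^ 2 ∂P ≤ (∑' k, ρ k) * windowDensity B N := by
  rw [integral_normSum_sq hY hr, windowDensity, ← mul_div_assoc]
  gcongr
  rw [mul_comm]
  refine le_trans ?_ (sum_sum_le_card_mul_tsum hρ hs _ (window B N))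
  exact Finset.sum_le_sum fun m _ => Finset.sum_le_sum fun n _ => (le_abs_self _).trans (hrρ _)

lemma charE_normSum_empty [IsProbabilityMeasure P] (t : ℝ) :
    charE P (normSum N (∅ : Set (Fin d → ℤ)) Y) t = 1 := by
  have h : window (∅ : Set (Fin d → ℤ)) N = ∅ := by ext n; simp [mem_window]
  simp [charE, normSum, h]

/-- Separated blocks are approximately independent. -/
lemma norm_charE_blocks_sub_prod_le [IsProbabilityMeasure P] {w : ℕ} {δ t : ℝ} (hδ : 0 ≤ δ)
    (hdep : ∀ A B : Set (Fin d → ℤ), A.Nonempty → B.Nonempty → Disjoint A B →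
      (w : ℝ) ≤ latticeDist A B →
      ‖charE P (normSum N (A ∪ B) Y) t
        - charE P (normSum N A Y) t * charE P (normSum N B Y) t‖ ≤ δ)
    (A : Set (Fin d → ℤ)) (i : Fin d) (L m : ℕ) :
    ‖charE P (normSum N (blocks A i N L w m) Y) t
      - ∏ j ∈ Finset.range m, charE P (normSum N (block A i N L w j) Y) t‖ ≤ m * δ := by
  induction m with
  | zero =>
    have : blocks A i N L w 0 = ∅ := by ext n; simp [blocks]
    simp [this, charE_normSum_empty]
  | succ m ih =>
    have step : ‖charE P (normSum N (blocks A i N L w (m + 1)) Y) t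
        - charE P (normSum N (blocks A i N L w m) Y) t
          * charE P (normSum N (block A i N L w m) Y) t‖ ≤ δ := by
      rw [blocks_succ]
      -- Weak dependence is assumed for nonempty sets only; an empty piece contributes the factor 1,
      -- with no error.
      rcases Set.eq_empty_or_nonempty (blocks A i N L w m) with h1 | h1
      · simpa [h1, charE_normSum_empty] using hδ
      rcases Set.eq_empty_or_nonempty (block A i N L w m) with h2 | h2
      · simpa [h2, charE_normSum_empty] using hδ
      refine hdep _ _ h1 h2 ?_ (le_latticeDist h1 h2 ?_)
      · rw [Set.disjoint_left]
        intro n hn hn'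
        exact hn.2.1.ne hn'.2.1
      · intro a ha b hb
        rw [norm_sub_rev]
        refine le_norm_sub_of_depth (i := i) (N := N) (L := L) ?_ hb.2.2
        rw [hb.2.1]; exact ha.2.1
    rw [Finset.prod_range_succ]
    refine (norm_sub_le_norm_sub_add_norm_sub _ _ _).trans ((add_le_add step ?_).trans_eq
      (b := δ + m * δ) (by push_cast; ring))
    rw [← sub_mul, norm_mul]
    exact (mul_le_of_le_one_right (norm_nonneg _) (norm_charE_le_one _ _)).trans ih

/-- The variance of a sum over `A`, compared with the sum of the variances over the blocks. -/
lemma abs_integral_sq_sub_sum_le (hY : ∀ n, MemLp (Y n) 2 P) {r ρ : (Fin d → ℤ) → ℝ}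
    (hr : ∀ m n, ∫ ω, Y m ω * Y n ω ∂P = r (n - m)) (hρ : ∀ k, 0 ≤ ρ k) (hs : Summable ρ)
    (hrρ : ∀ k, |r k| ≤ ρ k) (A : Set (Fin d → ℤ)) (i : Fin d) {L w M : ℕ}
    (hLM : 2 * N + 1 ≤ L * M) :
    |∫ ω, normSum N A Y ω ^ 2 ∂P
        - ∑ j ∈ Finset.range M, ∫ ω, normSum N (block A i N L w j) Y ω ^ 2 ∂P|
      ≤ 2 * ((M * w / (2 * (N : ℝ) + 1)) * ∑' k, ρ k)
        + ∑' k, {k : Fin d → ℤ | (w : ℝ) ≤ ‖k‖}.indicator ρ k := by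
  classical
  have h := abs_sum_sum_sub_sum_fiber_le hρ hs hrρ
    (window_blocks_subset (A := A) (i := i) (N := N) (L := L) (w := w) (M := M))
    (fun n => depth i N n / L) M (fun n hn => (mem_window.1 hn).2.2.1)
    {k : Fin d → ℤ | (w : ℝ) ≤ ‖k‖} (fun m hm n hn hne =>
      le_norm_sub_of_mem_blocks (mem_window.1 hm).2 (mem_window.1 hn).2 hne)
  rw [← window_corridor hLM] at h
  have hT : 0 ≤ ∑' k, {k : Fin d → ℤ | (w : ℝ) ≤ ‖k‖}.indicator ρ k :=
    tsum_nonneg fun k => Set.indicator_nonneg (fun k _ => hρ k) k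
  have hK : 0 ≤ ∑' k, ρ k := tsum_nonneg hρ
  set T := ∑' k, {k : Fin d → ℤ | (w : ℝ) ≤ ‖k‖}.indicator ρ k
  set K := ∑' k, ρ k
  have hD : (0 : ℝ) < (2 * (N : ℝ) + 1) ^ d := by positivity
  have e : ∫ ω, normSum N A Y ω ^ 2 ∂P
        - ∑ j ∈ Finset.range M, ∫ ω, normSum N (block A i N L w j) Y ω ^ 2 ∂P
      = (∑ m ∈ window A N, ∑ n ∈ window A N, r (n - m)
        - ∑ j ∈ Finset.range M,
          ∑ m ∈ window (blocks A i N L w M) N with depth i N m / L = j,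
            ∑ n ∈ window (blocks A i N L w M) N with depth i N n / L = j, r (n - m))
        / (2 * (N : ℝ) + 1) ^ d := by
    rw [integral_normSum_sq hY hr, sub_div, Finset.sum_div (Finset.range M)]
    refine congrArg _ (Finset.sum_congr rfl fun j hj => ?_)
    rw [integral_normSum_sq hY hr, window_block (Finset.mem_range.1 hj)]
  rw [e, abs_div, abs_of_pos hD]
  refine (div_le_div_of_nonneg_right h hD.le).trans ?_
  have c1 := windowDensity_corridor_le (w := w) A i hLM
  have c2 := windowDensity_le_one A N
  rw [add_div]
  refine add_le_add ?_ ?_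
  · calc _ = 2 * (windowDensity (corridor A i N L w) N * K) := by
          unfold windowDensity; ring
      _ ≤ _ := by gcongr
  · calc _ = windowDensity A N * T := by
          unfold windowDensity; ring
      _ ≤ _ := mul_le_of_le_one_left hT c2

/-- Bernstein's block estimate for the characteristic function of a normalized sum. -/
lemma norm_charE_normSum_sub_exp_le [IsProbabilityMeasure P] (hY : ∀ n, MemLp (Y n) 4 P)
    (h0 : ∀ n, ∫ ω, Y n ω ∂P = 0) {r ρ : (Fin d → ℤ) → ℝ}
    (hr : ∀ m n, ∫ ω, Y m ω * Y n ω ∂P = r (n - m)) (hρ : ∀ k, 0 ≤ ρ k) (hs : Summable ρ)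
    (hrρ : ∀ k, |r k| ≤ ρ k) {C : ℝ} (hC : 0 ≤ C)
    (h4 : ∀ B : Set (Fin d → ℤ), ∫ ω, normSum N B Y ω ^ 4 ∂P ≤ C * windowDensity B N ^ 2)
    {w : ℕ} {δ t : ℝ} (hδ : 0 ≤ δ)
    (hdep : ∀ A B : Set (Fin d → ℤ), A.Nonempty → B.Nonempty → Disjoint A B →
      (w : ℝ) ≤ latticeDist A B →
      ‖charE P (normSum N (A ∪ B) Y) t
        - charE P (normSum N A Y) t * charE P (normSum N B Y) t‖ ≤ δ)
    (A : Set (Fin d → ℤ)) (i : Fin d) {M : ℕ} (hM : 0 < M) (hMN : M ≤ 2 * N + 1)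
    {c : ℝ} (hc : 0 < c) :
    ‖charE P (normSum N A Y) t - (Real.exp (-(t ^ 2 / 2 * ∫ ω, normSum N A Y ω ^ 2 ∂P)) : ℂ)‖
      ≤ 2 * (c * t ^ 2 * ∑' k, ρ k)
        + (2 * (t ^ 4 / c * C) + (t ^ 2 / 2 * ∑' k, ρ k) ^ 2) * (2 / M)
        + (M * δ + t ^ 2 / 2 * ∑' k, {k : Fin d → ℤ | (w : ℝ) ≤ ‖k‖}.indicator ρ k)
        + (|t| * √((∑' k, ρ k) * (M * w / (2 * (N : ℝ) + 1)))
          + t ^ 2 / 2 * (2 * ((M * w / (2 * (N : ℝ) + 1)) * ∑' k, ρ k))) := by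
  set K := ∑' k, ρ k with hKdef
  have hK : 0 ≤ K := tsum_nonneg hρ
  -- Rounding the thickness up makes `M` slabs cover the box; `M ≤ 2 * N + 1` keeps the rounding
  -- cost within a factor 2.
  obtain ⟨L, hL, hLM, hLN⟩ : ∃ L : ℕ, 0 < L ∧ 2 * N + 1 ≤ L * M ∧
      (L : ℝ) / (2 * (N : ℝ) + 1) ≤ 2 / M := by
    refine ⟨(2 * N + 1) / M + 1, Nat.succ_pos _, ?_, ?_⟩
    · rw [mul_comm _ M]; exact (Nat.lt_mul_div_succ _ hM).le
    · rw [div_le_div_iff₀ (by positivity) (by positivity)]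
      have h1 : (2 * N + 1) / M * M ≤ 2 * N + 1 := Nat.div_mul_le_self _ _
      have h2 : ((2 * N + 1) / M + 1) * M ≤ 2 * (2 * N + 1) := by
        rw [add_mul]; omega
      exact_mod_cast h2
  have hY2 : ∀ n, MemLp (Y n) 2 P := fun n => memLp_two_of_memLp_four (hY n)
  have hvar : ∀ B : Set (Fin d → ℤ), ∫ ω, normSum N B Y ω ^ 2 ∂P ≤ K * windowDensity B N :=
    fun B => integral_normSum_sq_le hY2 hr hρ hs hrρ B
  have hvar0 : ∀ B : Set (Fin d → ℤ), 0 ≤ ∫ ω, normSum N B Y ω ^ 2 ∂P :=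
    fun B => integral_nonneg fun ω => by positivity
  set D : ℕ → Set (Fin d → ℤ) := fun j => block A i N L w j with hDdef
  set v : ℕ → ℝ := fun j => ∫ ω, normSum N (D j) Y ω ^ 2 ∂P with hv
  -- corridors
  have s1 : ‖charE P (normSum N A Y) t - charE P (normSum N (blocks A i N L w M) Y) t‖
      ≤ |t| * √(K * (M * w / (2 * (N : ℝ) + 1))) := by
    refine (norm_charE_sub_charE_le (memLp_normSum hY2 N _) (memLp_normSum hY2 N _) t).trans ?_
    simp_rw [normSum_sub_normSum_blocks hLM]
    gcongr
    refine (hvar _).trans ?_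
    gcongr
    exact windowDensity_corridor_le A i hLM
  have s2 := norm_charE_blocks_sub_prod_le hδ hdep A i L M
  -- blocks
  have s3 : ‖∏ j ∈ Finset.range M, charE P (normSum N (D j) Y) t
      - ∏ j ∈ Finset.range M, (Real.exp (-(t ^ 2 / 2 * v j)) : ℂ)‖
      ≤ 2 * (c * t ^ 2 * K) + (2 * (t ^ 4 / c * C) + (t ^ 2 / 2 * K) ^ 2) * (2 / M) := by
    refine (norm_prod_sub_prod_le_sum (fun j => norm_charE_le_one _ _) fun j => ?_).trans ?_
    · rw [Complex.norm_real, Real.norm_eq_abs, abs_of_pos (Real.exp_pos _), Real.exp_le_one_iff]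
      have : 0 ≤ t ^ 2 / 2 * v j := mul_nonneg (by positivity) (hvar0 _)
      linarith
    have hj : ∀ j ∈ Finset.range M, ‖charE P (normSum N (D j) Y) t
        - (Real.exp (-(t ^ 2 / 2 * v j)) : ℂ)‖
        ≤ (2 * (c * t ^ 2 * K) + (2 * (t ^ 4 / c * C) + (t ^ 2 / 2 * K) ^ 2) * (2 / M))
          * windowDensity (D j) N := by
      intro j _
      refine (norm_charE_sub_exp_le (memLp_normSum hY N _) (integral_normSum_eq_zero
        (fun n => (hY2 n).integrable (by norm_num)) h0 _) t hc).trans ?_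
      have p0 := windowDensity_nonneg (D j) N
      have p1 : windowDensity (D j) N ≤ 2 / M := (windowDensity_block_le A i N L w j hL).trans hLN
      set p := windowDensity (D j) N
      -- One factor `p` buys smallness; the other remains, to be summed over the blocks to at most
      -- 1.
      have p2 : p ^ 2 ≤ 2 / M * p := by rw [sq]; gcongr
      calc _ ≤ 2 * (c * t ^ 2 * (K * p)) + 2 * (t ^ 4 / c * (C * p ^ 2))
            + (t ^ 2 / 2 * (K * p)) ^ 2 := by
            gcongr
            · exact hvar _
            · exact h4 _
            · exact hvar _
        _ = 2 * (c * t ^ 2 * K) * p + (2 * (t ^ 4 / c * C) + (t ^ 2 / 2 * K) ^ 2) * p ^ 2 := by ring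
        _ ≤ 2 * (c * t ^ 2 * K) * p
            + (2 * (t ^ 4 / c * C) + (t ^ 2 / 2 * K) ^ 2) * (2 / M * p) := by gcongr
        _ = _ := by ring
    refine (Finset.sum_le_sum hj).trans ?_
    rw [← Finset.mul_sum]
    exact mul_le_of_le_one_right (by positivity) (sum_windowDensity_block_le A i N L w M)
  have s4 : ‖∏ j ∈ Finset.range M, (Real.exp (-(t ^ 2 / 2 * v j)) : ℂ)
      - (Real.exp (-(t ^ 2 / 2 * ∫ ω, normSum N A Y ω ^ 2 ∂P)) : ℂ)‖
      ≤ t ^ 2 / 2 * (2 * ((M * w / (2 * (N : ℝ) + 1)) * K)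
        + ∑' k, {k : Fin d → ℤ | (w : ℝ) ≤ ‖k‖}.indicator ρ k) := by
    rw [← Complex.ofReal_prod, ← Real.exp_sum, Finset.sum_neg_distrib, ← Finset.mul_sum,
      ← Complex.ofReal_sub, Complex.norm_real, Real.norm_eq_abs, abs_sub_comm]
    refine (abs_exp_neg_sub_exp_neg_le (mul_nonneg (by positivity) (hvar0 _))
      (mul_nonneg (by positivity) (Finset.sum_nonneg fun j _ => hvar0 _))).trans ?_
    rw [← mul_sub, abs_mul, abs_of_nonneg (by positivity : 0 ≤ t ^ 2 / 2)]
    gcongr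
    exact abs_integral_sq_sub_sum_le hY2 hr hρ hs hrρ A i hLM
  refine (norm_sub_le_norm_sub_add_norm_sub _ _ _).trans ((add_le_add s1
    ((norm_sub_le_norm_sub_add_norm_sub _ _ _).trans (add_le_add s2
      ((norm_sub_le_norm_sub_add_norm_sub _ _ _).trans (add_le_add s3 s4))))).trans_eq ?_)
  ring

end NormSum

/-! ### Limits at a fixed truncation level. -/

lemma tendsto_tsum_indicator_norm_ge {d : ℕ} {ρ : (Fin d → ℤ) → ℝ} (hρ : ∀ k, 0 ≤ ρ k)
    (hs : Summable ρ) :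
    Tendsto (fun w : ℕ => ∑' k, {k : Fin d → ℤ | (w : ℝ) ≤ ‖k‖}.indicator ρ k) atTop (𝓝 0) := by
  have h := tendsto_tsum_of_dominated_convergence (𝓕 := atTop)
    (f := fun (w : ℕ) k => {k : Fin d → ℤ | (w : ℝ) ≤ ‖k‖}.indicator ρ k) (g := fun _ => (0 : ℝ))
    hs (fun k => ?_) (.of_forall fun w k => ?_)
  · simpa using h
  · refine tendsto_const_nhds.congr' ?_
    filter_upwards [(tendsto_natCast_atTop_atTop (R := ℝ)).eventually_gt_atTop ‖k‖] with w hw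
    rw [Set.indicator_of_notMem]
    simpa using hw
  · refine (norm_indicator_le_norm_self _ _).trans_eq ?_
    rw [Real.norm_eq_abs, abs_of_nonneg (hρ k)]

section Limits

variable {d : ℕ} {Ω : ℕ → Type*} [∀ N, MeasurableSpace (Ω N)]
  {P : (N : ℕ) → Measure (Ω N)}
  {Y : (N : ℕ) → (Fin d → ℤ) → Ω N → ℝ} {r : ℕ → (Fin d → ℤ) → ℝ} {ρ : (Fin d → ℤ) → ℝ}

lemma tendsto_integral_normSum_sq (hY : ∀ N n, MemLp (Y N n) 2 (P N))
    (hr : ∀ N m n, ∫ ω, Y N m ω * Y N n ω ∂(P N) = r N (n - m))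
    (hs : Summable ρ) (hrρ : ∀ N k, |r N k| ≤ ρ k) {γ H : (Fin d → ℤ) → ℝ}
    (hγ : ∀ k, Tendsto (fun N => r N k) atTop (𝓝 (γ k))) {A : Set (Fin d → ℤ)}
    (hA : ∀ k, Tendsto (overlapN A k) atTop (𝓝 (H k))) :
    Tendsto (fun N => ∫ ω, normSum N A (Y N) ω ^ 2 ∂(P N)) atTop (𝓝 (∑' k, γ k * H k)) := by
  simp_rw [fun N => integral_normSum_sq (N := N) (hY N) (hr N) A, sum_sum_window_eq_tsum]
  refine tendsto_tsum_of_dominated_convergence hs (fun k => (hγ k).mul (hA k))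
    (.of_forall fun N k => ?_)
  rw [norm_mul, Real.norm_eq_abs, Real.norm_eq_abs, abs_of_nonneg (overlapN_nonneg A k N)]
  exact (mul_le_of_le_one_right (abs_nonneg _) (overlapN_le_one A k N)).trans (hrρ N k)

/-- The order of choice matters: `c` first, then `M` to beat `1 / c`, then `w` to beat the factor
`M` in front of `δ w`, and last `N`, which makes the corridors negligible. Each choice takes a
quarter of `ε`. -/
theorem tendsto_charE_normSum [∀ N, IsProbabilityMeasure (P N)] (i : Fin d) (hY : ∀ N n, MemLp (Y N n) 4 (P N))
    (h0 : ∀ N n, ∫ ω, Y N n ω ∂(P N) = 0)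
    (hr : ∀ N m n, ∫ ω, Y N m ω * Y N n ω ∂(P N) = r N (n - m))
    (hρ : ∀ k, 0 ≤ ρ k) (hs : Summable ρ) (hrρ : ∀ N k, |r N k| ≤ ρ k) {C : ℝ} (hC : 0 ≤ C)
    (h4 : ∀ N (B : Set (Fin d → ℤ)),
      ∫ ω, normSum N B (Y N) ω ^ 4 ∂(P N) ≤ C * windowDensity B N ^ 2)
    {t : ℝ} {δ : ℕ → ℝ} (hδ : ∀ w, 0 ≤ δ w) (hδ0 : Tendsto δ atTop (𝓝 0))
    (hdep : ∀ w : ℕ, 0 < w → ∀ N, ∀ A B : Set (Fin d → ℤ), A.Nonempty → B.Nonempty → Disjoint A B →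
      (w : ℝ) ≤ latticeDist A B →
      ‖charE (P N) (normSum N (A ∪ B) (Y N)) t
        - charE (P N) (normSum N A (Y N)) t * charE (P N) (normSum N B (Y N)) t‖ ≤ δ w)
    {A : Set (Fin d → ℤ)} {v : ℝ}
    (hv : Tendsto (fun N => ∫ ω, normSum N A (Y N) ω ^ 2 ∂(P N)) atTop (𝓝 v)) :
    Tendsto (fun N => charE (P N) (normSum N A (Y N)) t) atTop
      (𝓝 (Real.exp (-(t ^ 2 / 2 * v)) : ℂ)) := by
  set K := ∑' k, ρ k with hKdef
  have hK : 0 ≤ K := tsum_nonneg hρ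
  have hE : Tendsto (fun N => (Real.exp (-(t ^ 2 / 2 * ∫ ω, normSum N A (Y N) ω ^ 2 ∂(P N))) : ℂ))
      atTop (𝓝 (Real.exp (-(t ^ 2 / 2 * v)) : ℂ)) :=
    (Complex.continuous_ofReal.tendsto _).comp
      ((Real.continuous_exp.tendsto _).comp (hv.const_mul _).neg)
  have hdiff : Tendsto (fun N => charE (P N) (normSum N A (Y N)) t
      - (Real.exp (-(t ^ 2 / 2 * ∫ ω, normSum N A (Y N) ω ^ 2 ∂(P N))) : ℂ)) atTop (𝓝 0) := by
    rw [tendsto_zero_iff_norm_tendsto_zero]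
    refine tendsto_order.2 ⟨fun a ha => .of_forall fun N => ha.trans_le (norm_nonneg _),
      fun ε hε => ?_⟩
    obtain ⟨c, hc, hcε⟩ : ∃ c > 0, 2 * (c * t ^ 2 * K) < ε / 4 := by
      have : Tendsto (fun c : ℝ => 2 * (c * t ^ 2 * K)) (𝓝[>] 0) (𝓝 0) := by
        have : ContinuousAt (fun c : ℝ => 2 * (c * t ^ 2 * K)) 0 := by fun_prop
        simpa using this.tendsto.mono_left nhdsWithin_le_nhds
      obtain ⟨c, h1, h2⟩ :=
        ((this.eventually_lt_const (by positivity : 0 < ε / 4)).and self_mem_nhdsWithin).exists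
      exact ⟨c, h2, h1⟩
    obtain ⟨M, hM, hMε⟩ : ∃ M : ℕ, 0 < M ∧
        (2 * (t ^ 4 / c * C) + (t ^ 2 / 2 * K) ^ 2) * (2 / M) < ε / 4 := by
      have : Tendsto (fun M : ℕ => (2 * (t ^ 4 / c * C) + (t ^ 2 / 2 * K) ^ 2) * (2 / (M : ℝ)))
          atTop (𝓝 0) := by
        have h := (tendsto_const_div_atTop_nhds_zero_nat (2 : ℝ)).const_mul
          (2 * (t ^ 4 / c * C) + (t ^ 2 / 2 * K) ^ 2)
        rwa [mul_zero] at h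
      obtain ⟨M, h1, h2⟩ := ((this.eventually_lt_const (by positivity : 0 < ε / 4)).and
        (eventually_gt_atTop 0)).exists
      exact ⟨M, h2, h1⟩
    obtain ⟨w, hw, hwε⟩ : ∃ w : ℕ, 0 < w ∧ M * δ w
        + t ^ 2 / 2 * ∑' k, {k : Fin d → ℤ | (w : ℝ) ≤ ‖k‖}.indicator ρ k < ε / 4 := by
      have : Tendsto (fun w : ℕ => M * δ w
          + t ^ 2 / 2 * ∑' k, {k : Fin d → ℤ | (w : ℝ) ≤ ‖k‖}.indicator ρ k) atTop (𝓝 0) := by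
        simpa using (hδ0.const_mul (M : ℝ)).add
          ((tendsto_tsum_indicator_norm_ge hρ hs).const_mul (t ^ 2 / 2))
      obtain ⟨w, h1, h2⟩ := ((this.eventually_lt_const (by positivity : 0 < ε / 4)).and
        (eventually_gt_atTop 0)).exists
      exact ⟨w, h2, h1⟩
    have hq : Tendsto (fun N : ℕ => (M : ℝ) * w / (2 * (N : ℝ) + 1)) atTop (𝓝 0) := by
      refine Tendsto.div_atTop tendsto_const_nhds (tendsto_atTop_add_const_right _ _
        (tendsto_natCast_atTop_atTop.const_mul_atTop (by norm_num)))
    have hN : Tendsto (fun N : ℕ => |t| * √(K * (M * w / (2 * (N : ℝ) + 1)))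
          + t ^ 2 / 2 * (2 * ((M * w / (2 * (N : ℝ) + 1)) * K))) atTop (𝓝 0) := by
      have h1 := ((Real.continuous_sqrt.tendsto _).comp (hq.const_mul K)).const_mul |t|
      have h2 := ((hq.mul_const K).const_mul 2).const_mul (t ^ 2 / 2)
      simpa using h1.add h2
    filter_upwards [hN.eventually_lt_const (by positivity : 0 < ε / 4),
      eventually_ge_atTop M] with N hNε hNM
    have := norm_charE_normSum_sub_exp_le (N := N) (hY N) (h0 N) (hr N) hρ hs (hrρ N) hC (h4 N)
      (hδ w) (hdep w hw N) A i hM (by omega) hc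
    linarith
  simpa using hdiff.add hE

end Limits

/-! ### Truncated stationary fields. -/

section Truncation

variable {d : ℕ} {Ω : Type*} [MeasurableSpace Ω] {P : Measure Ω} {X : (Fin d → ℤ) → Ω → ℝ}

/-- Truncation of a real number at level `J`. -/
noncomputable def truncReal (J x : ℝ) : ℝ := {y : ℝ | |y| ≤ J}.indicator id x

lemma measurable_truncReal (J : ℝ) : Measurable (truncReal J) :=
  measurable_id.indicator (measurableSet_le measurable_id.abs measurable_const)

lemma abs_truncReal_le {J : ℝ} (hJ : 0 ≤ J) (x : ℝ) : |truncReal J x| ≤ J := by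
  by_cases h : x ∈ {y : ℝ | |y| ≤ J}
  · rw [truncReal, Set.indicator_of_mem h]; exact h
  · rw [truncReal, Set.indicator_of_notMem h]; simpa using hJ

lemma truncField_eq (J : ℝ) (n : Fin d → ℤ) (ω : Ω) :
    truncField P X J n ω = truncReal J (X n ω) - ∫ ω', truncReal J (X n ω') ∂P := rfl

lemma integrable_truncReal [IsFiniteMeasure P] {J : ℝ} (hJ : 0 ≤ J) {Z : Ω → ℝ}
    (hZ : AEMeasurable Z P) : Integrable (fun ω => truncReal J (Z ω)) P :=
  Integrable.of_bound ((measurable_truncReal J).comp_aemeasurable hZ).aestronglyMeasurable J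
    (.of_forall fun ω => abs_truncReal_le hJ (Z ω))

lemma memLp_truncField [IsProbabilityMeasure P] {J : ℝ} (hJ : 0 ≤ J)
    (hX : ∀ n, AEMeasurable (X n) P) (p : ENNReal) (n : Fin d → ℤ) :
    MemLp (truncField P X J n) p P := by
  have h : MemLp (fun ω => truncReal J (X n ω)) p P :=
    MemLp.of_bound ((measurable_truncReal J).comp_aemeasurable (hX n)).aestronglyMeasurable J
      (.of_forall fun ω => abs_truncReal_le hJ _)
  exact h.sub (memLp_const _)

lemma integral_truncField [IsProbabilityMeasure P] {J : ℝ} (hJ : 0 ≤ J)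
    (hX : ∀ n, AEMeasurable (X n) P) (n : Fin d → ℤ) : ∫ ω, truncField P X J n ω ∂P = 0 := by
  simp_rw [truncField_eq]
  rw [integral_sub (integrable_truncReal hJ (hX n)) (integrable_const _)]
  simp

lemma IsStationaryField.integral_truncReal (h : IsStationaryField P X) (J : ℝ) (n : Fin d → ℤ) :
    ∫ ω, truncReal J (X n ω) ∂P = ∫ ω, truncReal J (X 0 ω) ∂P := by
  have := ((h n).comp (u := fun x : (Fin d → ℤ) → ℝ => truncReal J (x 0))
    ((measurable_truncReal J).comp (measurable_pi_apply 0))).integral_eq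
  simpa [Function.comp_def] using this

/-- By stationarity all centering constants agree, so the product is one fixed measurable function
of the translated field. -/
lemma IsStationaryField.integral_truncField_mul (h : IsStationaryField P X) (J : ℝ)
    (m n : Fin d → ℤ) :
    ∫ ω, truncField P X J m ω * truncField P X J n ω ∂P
      = fieldCov P (truncField P X J) (n - m) := by
  unfold fieldCov
  simp_rw [truncField_eq, h.integral_truncReal J]
  set a := ∫ ω, truncReal J (X 0 ω) ∂P
  have hm : Measurable fun x : (Fin d → ℤ) → ℝ =>
      (truncReal J (x 0) - a) * (truncReal J (x (n - m)) - a) :=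
    (((measurable_truncReal J).comp (measurable_pi_apply 0)).sub_const a).mul
      (((measurable_truncReal J).comp (measurable_pi_apply (n - m))).sub_const a)
  have := ((h m).comp hm).integral_eq
  simpa [Function.comp_def] using this

end Truncation

/-! ### The limit theorem and the removal of the truncation. -/

theorem theorem2 {d : ℕ} (hd : 1 ≤ d)
    {Ω : ℕ → Type*} [∀ N, MeasurableSpace (Ω N)]
    (P : (N : ℕ) → Measure (Ω N)) [∀ N, IsProbabilityMeasure (P N)]
    (X : (N : ℕ) → (Fin d → ℤ) → Ω N → ℝ)
    -- stationary, centered, square integrable, with summable covariances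
    (h_stationary : ∀ N, IsStationaryField (P N) (X N))
    (h_memLp : ∀ N n, MemLp (X N n) 2 (P N))
    (h_centered : ∀ N n, ∫ ω, X N n ω ∂(P N) = 0)
    (h_summable : ∀ N, Summable fun k => |fieldCov (P N) (X N) k|)
    -- domination of the truncated covariances, uniformly in the truncation level and in `N`
    (h_dominated : ∃ ρ : (Fin d → ℤ) → ℝ, (∀ k, 0 ≤ ρ k) ∧ Summable ρ ∧
      ∀ J > 0, ∀ N k, |fieldCov (P N) (truncField (P N) (X N) J) k| ≤ ρ k)
    -- the truncation error in mean square
    (h_truncation : ∃ b : ℝ → ℝ, Tendsto b atTop (𝓝 0) ∧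
      ∀ J > 0, ∀ (B : Set (Fin d → ℤ)) (N : ℕ),
        ∫ ω, (normSum N B (X N) ω - normSum N B (truncField (P N) (X N) J) ω) ^ 2 ∂(P N)
          ≤ b J * (((window B N).card : ℝ) / (2 * (N : ℝ) + 1) ^ d))
    -- fourth moments of the truncated sums
    (h_fourth : ∀ J > 0, ∃ C : ℝ, ∀ (B : Set (Fin d → ℤ)) (N : ℕ),
      ∫ ω, normSum N B (truncField (P N) (X N) J) ω ^ 4 ∂(P N)
        ≤ C * (((window B N).card : ℝ) / (2 * (N : ℝ) + 1) ^ d) ^ 2)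
    -- weak dependence
    (h_weakDep : ∃ (h : ℝ → ℝ) (g : ℝ → ℝ → ℝ),
      (∀ x > 0, 0 ≤ h x) ∧ AntitoneOn h (Set.Ioi 0) ∧ Tendsto h atTop (𝓝 0) ∧
      (∀ J > 0, BddAbove (Set.range (g J))) ∧
      ∀ J > 0, ∀ A B : Set (Fin d → ℤ), A.Nonempty → B.Nonempty → Disjoint A B →
        ∀ (N : ℕ) (t : ℝ),
          ‖charE (P N) (normSum N (A ∪ B) (truncField (P N) (X N) J)) t
              - charE (P N) (normSum N A (truncField (P N) (X N) J)) t
                * charE (P N) (normSum N B (truncField (P N) (X N) J)) t‖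
            ≤ g J t * h (latticeDist A B))
    -- limits of the truncated covariances
    (γJ : ℝ → (Fin d → ℤ) → ℝ) (γ : (Fin d → ℤ) → ℝ)
    (h_limN : ∀ J > 0, ∀ k,
      Tendsto (fun N => fieldCov (P N) (truncField (P N) (X N) J) k) atTop (𝓝 (γJ J k)))
    (h_limJ : ∀ k, Tendsto (fun J => γJ J k) atTop (𝓝 (γ k)))
    (A : Set (Fin d → ℤ)) (hA : IsAsymptoticallyMeasurable A) :
    (Summable fun k => γ k * overlap k A) ∧
    0 ≤ (∑' k, γ k * overlap k A) ∧
    TendstoInDistribution (fun N => normSum N A (X N)) atTop (id : ℝ → ℝ) P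
      (gaussianReal 0 (Real.toNNReal (∑' k, γ k * overlap k A))) := by
  obtain ⟨ρ, hρ, hs, hdom⟩ := h_dominated
  obtain ⟨b, hb, htr⟩ := h_truncation
  obtain ⟨h, g, hh0, hanti, hh, hg, hdep⟩ := h_weakDep
  have hXm : ∀ N n, AEMeasurable (X N n) (P N) := fun N n => (h_memLp N n).aemeasurable
  have hov : ∀ k, Tendsto (overlapN A k) atTop (𝓝 (overlap k A)) := fun k =>
    tendsto_nhds_limUnder (hA k)
  have hov0 : ∀ k, 0 ≤ overlap k A := fun k =>
    ge_of_tendsto (hov k) (.of_forall fun N => overlapN_nonneg A k N)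
  have hov1 : ∀ k, overlap k A ≤ 1 := fun k =>
    le_of_tendsto (hov k) (.of_forall fun N => overlapN_le_one A k N)
  have hγJ : ∀ J > 0, ∀ k, |γJ J k| ≤ ρ k := fun J hJ k =>
    le_of_tendsto (h_limN J hJ k).abs (.of_forall fun N => hdom J hJ N k)
  have hγ : ∀ k, |γ k| ≤ ρ k := fun k =>
    le_of_tendsto (h_limJ k).abs ((eventually_gt_atTop 0).mono fun J hJ => hγJ J hJ k)
  have hbound : ∀ {c : (Fin d → ℤ) → ℝ}, (∀ k, |c k| ≤ ρ k) →
      ∀ k, ‖c k * overlap k A‖ ≤ ρ k := by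
    intro c hc k
    rw [norm_mul, Real.norm_eq_abs, Real.norm_eq_abs, abs_of_nonneg (hov0 k)]
    exact (mul_le_of_le_one_right (abs_nonneg _) (hov1 k)).trans (hc k)
  have hsum : Summable fun k => γ k * overlap k A := Summable.of_norm_bounded hs (hbound hγ)
  set σ := ∑' k, γ k * overlap k A with hσ
  have hσJ : Tendsto (fun J => ∑' k, γJ J k * overlap k A) atTop (𝓝 σ) :=
    tendsto_tsum_of_dominated_convergence hs (fun k => (h_limJ k).mul_const _)
      ((eventually_gt_atTop 0).mono fun J hJ => hbound (hγJ J hJ))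
  have hvar : ∀ J > 0, Tendsto
      (fun N => ∫ ω, normSum N A (truncField (P N) (X N) J) ω ^ 2 ∂(P N)) atTop
      (𝓝 (∑' k, γJ J k * overlap k A)) := fun J hJ =>
    tendsto_integral_normSum_sq (fun N => memLp_truncField hJ.le (hXm N) 2)
      (fun N => (h_stationary N).integral_truncField_mul J) hs (hdom J hJ) (h_limN J hJ) hov
  have hσ0 : 0 ≤ σ := by
    refine ge_of_tendsto hσJ ((eventually_gt_atTop 0).mono fun J hJ => ?_)
    exact ge_of_tendsto (hvar J hJ) (.of_forall fun N => integral_nonneg fun ω => by positivity)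
  refine ⟨hsum, hσ0, ?_⟩
  have htrunc : ∀ J > 0, ∀ t, Tendsto
      (fun N => charE (P N) (normSum N A (truncField (P N) (X N) J)) t) atTop
      (𝓝 (Real.exp (-(t ^ 2 / 2 * ∑' k, γJ J k * overlap k A)) : ℂ)) := by
    intro J hJ t
    obtain ⟨C, hC⟩ := h_fourth J hJ
    obtain ⟨G, hG⟩ := hg J hJ
    -- The signs of `C` and `G` are unknown, and `h` is constrained only on positive reals while `δ
    -- 0` must also be nonnegative. Any coordinate would do; `hd` provides one.
    refine tendsto_charE_normSum (C := max C 0) (δ := fun w => max G 0 * |h w|) ⟨0, hd⟩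
      (fun N => memLp_truncField hJ.le (hXm N) 4) (fun N => integral_truncField hJ.le (hXm N))
      (fun N => (h_stationary N).integral_truncField_mul J) hρ hs (hdom J hJ) (le_max_right _ _)
      (fun N B => (hC B N).trans ?_) (fun w => by positivity) ?_ ?_ (hvar J hJ)
    · exact mul_le_mul_of_nonneg_right (le_max_left _ _) (sq_nonneg _)
    · simpa using ((hh.comp tendsto_natCast_atTop_atTop).abs).const_mul (max G 0)
    · intro w hw N B₁ B₂ h₁ h₂ h₁₂ hdist
      have hw' : (0 : ℝ) < w := by exact_mod_cast hw
      refine (hdep J hJ B₁ B₂ h₁ h₂ h₁₂ N t).trans ?_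
      have e1 : h (latticeDist B₁ B₂) ≤ |h w| :=
        (hanti hw' (hw'.trans_le hdist) hdist).trans (le_abs_self _)
      have e2 : g J t ≤ max G 0 := (hG ⟨t, rfl⟩).trans (le_max_left _ _)
      exact mul_le_mul e2 e1 (hh0 _ (hw'.trans_le hdist)) (le_max_right _ _)
  have hS : ∀ N, MemLp (normSum N A (X N)) 2 (P N) := fun N => memLp_normSum (h_memLp N) N A
  have hchar : ∀ t, Tendsto (fun N => charE (P N) (normSum N A (X N)) t) atTop
      (𝓝 (Real.exp (-(t ^ 2 / 2 * σ)) : ℂ)) := by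
    intro t
    rw [Metric.tendsto_atTop']
    intro ε hε
    have l1 : Tendsto (fun J => |t| * √|b J|) atTop (𝓝 0) := by
      simpa using ((Real.continuous_sqrt.tendsto _).comp hb.abs).const_mul |t|
    have l2 : Tendsto (fun J => (Real.exp (-(t ^ 2 / 2 * ∑' k, γJ J k * overlap k A)) : ℂ)) atTop
        (𝓝 (Real.exp (-(t ^ 2 / 2 * σ)) : ℂ)) :=
      (Complex.continuous_ofReal.tendsto _).comp
        ((Real.continuous_exp.tendsto _).comp (hσJ.const_mul _).neg)
    -- `J` can be fixed before `N` because the truncation error is bounded uniformly in `N`.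
    obtain ⟨J, ⟨hJ1, hJ2⟩, hJ⟩ := ((l1.eventually_lt_const (by positivity : 0 < ε / 3)).and
      ((Metric.tendsto_nhds.1 l2) (ε / 3) (by positivity)) |>.and (eventually_gt_atTop 0)).exists
    obtain ⟨N₀, hN₀⟩ := Metric.tendsto_atTop'.1 (htrunc J hJ t) (ε / 3) (by positivity)
    refine ⟨N₀, fun N hN => ?_⟩
    have hN := hN₀ N hN
    have h3 : dist (charE (P N) (normSum N A (X N)) t)
        (charE (P N) (normSum N A (truncField (P N) (X N) J)) t) ≤ |t| * √|b J| := by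
      rw [dist_eq_norm]
      refine (norm_charE_sub_charE_le (hS N)
        (memLp_normSum (memLp_truncField hJ.le (hXm N) 2) N A) t).trans ?_
      gcongr
      refine (htr J hJ A N).trans ((mul_le_mul_of_nonneg_right (le_abs_self _)
        (windowDensity_nonneg A N)).trans ?_)
      exact mul_le_of_le_one_right (abs_nonneg _) (windowDensity_le_one A N)
    have h4 := dist_triangle4 (charE (P N) (normSum N A (X N)) t)
      (charE (P N) (normSum N A (truncField (P N) (X N) J)) t)
      (Real.exp (-(t ^ 2 / 2 * ∑' k, γJ J k * overlap k A)) : ℂ)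
      (Real.exp (-(t ^ 2 / 2 * σ)) : ℂ)
    linarith
  refine ⟨fun N => (hS N).aemeasurable, aemeasurable_id, ?_⟩
  refine ProbabilityMeasure.tendsto_iff_tendsto_charFun.2 fun t => ?_
  -- `σ` is the variance itself; the degenerate case `σ = 0` needs no separate treatment.
  have e : charFun ((gaussianReal 0 σ.toNNReal).map id) t = (Real.exp (-(t ^ 2 / 2 * σ)) : ℂ) := by
    rw [Measure.map_id, charFun_gaussianReal]
    simp only [Real.coe_toNNReal _ hσ0]
    push_cast
    congr 1
    ring
  change Tendsto (fun N => charFun ((P N).map (normSum N A (X N))) t) atTop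
    (𝓝 (charFun ((gaussianReal 0 σ.toNNReal).map id) t))
  rw [e]
  simp_rw [← fun N => charE_eq_charFun (hS N).aemeasurable t]
  exact hchar t
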